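/- All graphs are finite and simple; $K_v$ is the complete graph on $v$ vertices and $P_k$ the path on $k$ vertices. A $(K,\Gamma)$-design is a set of subgraphs of $K$ (called blocks), each isomorphic to $\Gamma$, whose edge sets partition the edge set of $K$; a $\Gamma$-design of order $v$ is a $(K_v,\Gamma)$-design, for any choice of the vertex set of $K_v$. A $P_4$-design $\mathcal B$ can be down-linked to a $P_3$-design $\mathcal B'$ if there is a map $f:\mathcal B\to\mathcal B'$ such that $f(B)$ is a subgraph of $B$ for every $B\in\mathcal B$. Let $\mathcal L_1P_4(v)$ be the set of all integers $n$ such that some $P_4$-design of order $v$ can be down-linked to a $P_3$-design of order $n$, and let $\mathcal L_2P_4(v)$ be the set of all integers $n$ such that every $P_4$-design of order $v$ can be down-linked to a $P_3$-design of order $n$. Theorem. For every admissible integer $v>1$, that is, for every $v\ge 4$ with $v(v-1)\equiv 0 \pmod 6$, $$\mathcal L_1P_4(v)=\{n\ge v-1 : n\equiv 0,1 \pmod 4\},\qquad \mathcal L_2P_4(v)\subseteq\{n\ge v : n\equiv 0,1 \pmod 4\}.$$ -/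

import Mathlib

/-- A (labelled) graph whose vertex set is a subset of `ℕ`: a subgraph of the complete graph on `ℕ`.
All graphs of the theory are finite, so nothing is lost by taking vertices in one countable set;
the relation `H ≤ G` is the usual subgraph relation (vertices and edges). -/
abbrev LGraph : Type := (⊤ : SimpleGraph ℕ).Subgraph

/-- The complete graph `K_V` with vertex set `V`. -/
def completeOn (V : Finset ℕ) : LGraph :=
  (⊤ : LGraph).induce (V : Set ℕ)

/-- `𝓑` is a `(K, Γ)`-design: a set of subgraphs of `K`, each isomorphic to `Γ`, whose edge sets
partition the edge set of `K`. -/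
structure IsDesign {W : Type*} (𝓑 : Set LGraph) (K : LGraph) (Γ : SimpleGraph W) : Prop where
  le : ∀ B ∈ 𝓑, B ≤ K
  iso : ∀ B ∈ 𝓑, Nonempty (B.coe ≃g Γ)
  partition : ∀ e ∈ K.edgeSet, ∃! B : LGraph, B ∈ 𝓑 ∧ e ∈ B.edgeSet

/-- `𝓑` is a `Γ`-design of order `v`, that is a `(K_v, Γ)`-design, where `K_v` is the complete
graph on some set of `v` vertices. -/
def IsDesignOfOrder {W : Type*} (𝓑 : Set LGraph) (v : ℕ) (Γ : SimpleGraph W) : Prop :=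
  ∃ V : Finset ℕ, V.card = v ∧ IsDesign 𝓑 (completeOn V) Γ

/-- A down-link from `𝓑` to `𝓑'`: a map sending each block to one of its subgraphs. -/
def IsDownLink {𝓑 𝓑' : Set LGraph} (f : 𝓑 → 𝓑') : Prop :=
  ∀ B : 𝓑, (f B : LGraph) ≤ (B : LGraph)

/-- It is possible to down-link `𝓑` to `𝓑'`. -/
def CanDownLink (𝓑 𝓑' : Set LGraph) : Prop :=
  ∃ f : 𝓑 → 𝓑', IsDownLink f

/-- `ℒ₁Γ(v)`, with target graph `Γ'`: the set of all `n` such that some `Γ`-design of order `v`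
can be down-linked to a `Γ'`-design of order `n`. -/
def downLinkSpectrum₁ {W W' : Type*} (Γ : SimpleGraph W) (Γ' : SimpleGraph W') (v : ℕ) : Set ℕ :=
  {n | ∃ 𝓑 𝓑' : Set LGraph,
    IsDesignOfOrder 𝓑 v Γ ∧ IsDesignOfOrder 𝓑' n Γ' ∧ CanDownLink 𝓑 𝓑'}

/-- `ℒ₂Γ(v)`, with target graph `Γ'`: the set of all `n` such that every `Γ`-design of order `v`
can be down-linked to a `Γ'`-design of order `n`. -/
def downLinkSpectrum₂ {W W' : Type*} (Γ : SimpleGraph W) (Γ' : SimpleGraph W') (v : ℕ) : Set ℕ :=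
  {n | ∀ 𝓑 : Set LGraph, IsDesignOfOrder 𝓑 v Γ →
    ∃ 𝓑' : Set LGraph, IsDesignOfOrder 𝓑' n Γ' ∧ CanDownLink 𝓑 𝓑'}

/-- `v` is admissible for the path `P_k` on `k` vertices (`k ≥ 2`): the necessary arithmetic
conditions for the existence of a `(K_v, P_k)`-design with at least one block. -/
def PathAdmissible (k v : ℕ) : Prop :=
  k ≤ v ∧ v * (v - 1) ≡ 0 [MOD 2 * (k - 1)]

/-! Necessity. Deleting edges from a `P₄` to reach a `P₃` loses exactly one vertex, an end of the
path. So if two vertices of `V` were missing from the target vertex set `V'`, the block containing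
the edge between them could not be linked; hence `V'.card ≥ v - 1`. Moreover a vertex that is inner
in some block must lie in `V'`. Designs in which every vertex is inner exist for all admissible
orders (`exists_linked_completeEdges`), which forces `n ≥ v` in the second spectrum. A `P₃`-design
of order `n` needs `n.choose 2` even, that is `n ≡ 0, 1` modulo 4.

Sufficiency, in the first spectrum. Linked pairs of decompositions of edge-disjoint pieces can be
united (`Linked.union`), so `n = v` and `n = v - 1` reduce to finitely many tables by splitting off
12 vertices (`linked_completeEdges_self`, `linked_completeEdges_insert`); for `n = v - 1` the extra
vertex is an end of every block through it and is always cut off. For `n > v`, cut an end edge off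
each block of a `P₄`-design on `V`. The uncovered edges of the larger complete graph include all
edges at a new vertex `w`, and parity alone lets such a graph be decomposed into copies of `P₃`
(`exists_decomposes_of_dominating`). -/

open SimpleGraph

/-! ### Copies of the two paths inside the complete graph on `ℕ` -/

/-- The path `a - b - c`. -/
def pathThree (a b c : ℕ) : LGraph where
  verts := {a, b, c}
  -- The condition `u ≠ v` yields a subgraph of `⊤` even when the named vertices coincide.
  Adj u v := u ≠ v ∧ (s(u, v) = s(a, b) ∨ s(u, v) = s(b, c))
  adj_sub h := h.1
  edge_vert {u v} h := by
    obtain ⟨-, h⟩ := h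
    simp only [Sym2.eq_iff] at h
    simp only [Set.mem_insert_iff, Set.mem_singleton_iff]
    tauto
  symm := ⟨fun u v h => by rw [Sym2.eq_swap]; exact ⟨h.1.symm, h.2⟩⟩

/-- The path `a - b - c - d`. -/
def pathFour (a b c d : ℕ) : LGraph where
  verts := {a, b, c, d}
  Adj u v := u ≠ v ∧ (s(u, v) = s(a, b) ∨ s(u, v) = s(b, c) ∨ s(u, v) = s(c, d))
  adj_sub h := h.1
  edge_vert {u v} h := by
    obtain ⟨-, h⟩ := h
    simp only [Sym2.eq_iff] at h
    simp only [Set.mem_insert_iff, Set.mem_singleton_iff]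
    tauto
  symm := ⟨fun u v h => by rw [Sym2.eq_swap]; exact ⟨h.1.symm, h.2⟩⟩

/-- An injection into `ℕ` as a copy of a graph in the complete graph on `ℕ`. -/
def copyOfEmbedding {W : Type*} (Γ : SimpleGraph W) (p : W ↪ ℕ) : Copy Γ (⊤ : SimpleGraph ℕ) :=
  ⟨⟨p, fun h => p.injective.ne h.ne⟩, p.injective⟩

theorem copyOfEmbedding_toSubgraph_three (p : Fin 3 ↪ ℕ) :
    (copyOfEmbedding (pathGraph 3) p).toSubgraph = pathThree (p 0) (p 1) (p 2) := by
  have h01 : p 0 ≠ p 1 := p.injective.ne (by decide)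
  have h12 : p 1 ≠ p 2 := p.injective.ne (by decide)
  ext u v
  · simp [copyOfEmbedding, pathThree, Fin.exists_fin_succ, eq_comm]
  · simp only [Copy.toSubgraph, Subgraph.map, Relation.Map, copyOfEmbedding, pathThree,
      Fin.exists_fin_succ, Subgraph.top_adj, pathGraph_adj]
    simp
    grind

theorem copyOfEmbedding_toSubgraph_four (p : Fin 4 ↪ ℕ) :
    (copyOfEmbedding (pathGraph 4) p).toSubgraph = pathFour (p 0) (p 1) (p 2) (p 3) := by
  have h01 : p 0 ≠ p 1 := p.injective.ne (by decide)
  have h12 : p 1 ≠ p 2 := p.injective.ne (by decide)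
  have h23 : p 2 ≠ p 3 := p.injective.ne (by decide)
  ext u v
  · simp [copyOfEmbedding, pathFour, Fin.exists_fin_succ, eq_comm]
  · simp only [Copy.toSubgraph, Subgraph.map, Relation.Map, copyOfEmbedding, pathFour,
      Fin.exists_fin_succ, Subgraph.top_adj, pathGraph_adj]
    simp
    grind

theorem exists_embedding_of_iso {W : Type*} {Γ : SimpleGraph W} {B : LGraph}
    (h : Nonempty (B.coe ≃g Γ)) : ∃ p : W ↪ ℕ, (copyOfEmbedding Γ p).toSubgraph = B := by
  obtain ⟨e⟩ := h
  have : B ∈ Set.range (Copy.toSubgraph (A := Γ) (B := (⊤ : SimpleGraph ℕ))) := by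
    rw [Copy.range_toSubgraph]; exact ⟨e.symm⟩
  obtain ⟨f, hf⟩ := this
  exact ⟨f.toEmbedding, hf⟩

theorem nonempty_iso_pathThree_iff {B : LGraph} : Nonempty (B.coe ≃g pathGraph 3) ↔
    ∃ a b c, a ≠ b ∧ a ≠ c ∧ b ≠ c ∧ B = pathThree a b c := by
  constructor
  · intro h
    obtain ⟨p, rfl⟩ := exists_embedding_of_iso h
    exact ⟨p 0, p 1, p 2, p.injective.ne (by decide), p.injective.ne (by decide),
      p.injective.ne (by decide), copyOfEmbedding_toSubgraph_three p⟩
  · rintro ⟨a, b, c, hab, hac, hbc, rfl⟩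
    have hp : Function.Injective ![a, b, c] := by
      intro i j; fin_cases i <;> fin_cases j <;> simp [*, Ne.symm, eq_comm]
    have := copyOfEmbedding_toSubgraph_three ⟨_, hp⟩
    simp only [Function.Embedding.coeFn_mk, Matrix.cons_val] at this
    rw [← this]
    exact ⟨(Copy.isoToSubgraph _).symm⟩

theorem nonempty_iso_pathFour_iff {B : LGraph} : Nonempty (B.coe ≃g pathGraph 4) ↔
    ∃ a b c d, a ≠ b ∧ a ≠ c ∧ a ≠ d ∧ b ≠ c ∧ b ≠ d ∧ c ≠ d ∧ B = pathFour a b c d := by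
  constructor
  · intro h
    obtain ⟨p, rfl⟩ := exists_embedding_of_iso h
    exact ⟨p 0, p 1, p 2, p 3, p.injective.ne (by decide), p.injective.ne (by decide),
      p.injective.ne (by decide), p.injective.ne (by decide), p.injective.ne (by decide),
      p.injective.ne (by decide), copyOfEmbedding_toSubgraph_four p⟩
  · rintro ⟨a, b, c, d, hab, hac, had, hbc, hbd, hcd, rfl⟩
    have hp : Function.Injective ![a, b, c, d] := by
      intro i j; fin_cases i <;> fin_cases j <;> simp [*, Ne.symm, eq_comm]
    have := copyOfEmbedding_toSubgraph_four ⟨_, hp⟩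
    simp only [Function.Embedding.coeFn_mk, Matrix.cons_val] at this
    rw [← this]
    exact ⟨(Copy.isoToSubgraph _).symm⟩

theorem mem_edgeSet_pathThree {a b c : ℕ} (hab : a ≠ b) (hbc : b ≠ c) {e : Sym2 ℕ} :
    e ∈ (pathThree a b c).edgeSet ↔ e = s(a, b) ∨ e = s(b, c) := by
  induction e with | _ u v
  simp only [Subgraph.mem_edgeSet, pathThree, Sym2.eq_iff]
  grind

theorem mem_edgeSet_pathFour {a b c d : ℕ} (hab : a ≠ b) (hbc : b ≠ c) (hcd : c ≠ d)
    {e : Sym2 ℕ} :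
    e ∈ (pathFour a b c d).edgeSet ↔ e = s(a, b) ∨ e = s(b, c) ∨ e = s(c, d) := by
  induction e with | _ u v
  simp only [Subgraph.mem_edgeSet, pathFour, Sym2.eq_iff]
  grind

theorem pathThree_le_pathFour (a b c d : ℕ) : pathThree b c d ≤ pathFour a b c d := by
  refine ⟨fun x hx => Or.inr hx, fun u v h => ⟨h.1, Or.inr h.2⟩⟩

/-! ### Edge sets and their disjoint unions -/

/-- The edges of the complete graph on `V`. -/
def completeEdges {α : Type*} [DecidableEq α] (V : Finset α) : Finset (Sym2 α) :=
  V.offDiag.image Sym2.mk.uncurry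

/-- The edges of the complete bipartite graph between `A` and `B`. -/
def bipartiteEdges {α : Type*} [DecidableEq α] (A B : Finset α) : Finset (Sym2 α) :=
  (A ×ˢ B).image Sym2.mk.uncurry

/-- `𝓑` decomposes the set of edges `E` into copies of `Γ`. -/
structure Decomposes {W : Type*} (𝓑 : Set LGraph) (Γ : SimpleGraph W) (E : Finset (Sym2 ℕ)) :
    Prop where
  iso : ∀ B ∈ 𝓑, Nonempty (B.coe ≃g Γ)
  subset : ∀ B ∈ 𝓑, ∀ e ∈ B.edgeSet, e ∈ E
  partition : ∀ e ∈ E, ∃! B : LGraph, B ∈ 𝓑 ∧ e ∈ B.edgeSet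

section edges

variable {α β : Type*} [DecidableEq α] [DecidableEq β]

theorem mk_mem_completeEdges {V : Finset α} {u v : α} :
    s(u, v) ∈ completeEdges V ↔ u ∈ V ∧ v ∈ V ∧ u ≠ v := by
  simp only [completeEdges, Finset.mem_image, Finset.mem_offDiag, Prod.exists,
    Function.uncurry_apply_pair, Sym2.eq_iff]
  grind

theorem mk_mem_bipartiteEdges {A B : Finset α} {u v : α} :
    s(u, v) ∈ bipartiteEdges A B ↔ (u ∈ A ∧ v ∈ B) ∨ (v ∈ A ∧ u ∈ B) := by
  simp only [bipartiteEdges, Finset.mem_image, Finset.mem_product, Prod.exists,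
    Function.uncurry_apply_pair, Sym2.eq_iff]
  grind

theorem map_completeEdges (g : α ↪ β) (V : Finset α) :
    (completeEdges V).map g.sym2Map = completeEdges (V.map g) := by
  ext e
  induction e with | _ u v
  rw [mk_mem_completeEdges]
  simp only [completeEdges, Finset.mem_map, Finset.mem_image,
    Finset.mem_offDiag, Prod.exists, Function.uncurry_apply_pair]
  constructor
  · rintro ⟨_, ⟨a, b, ⟨ha, hb, hab⟩, rfl⟩, h⟩
    simp only [Function.Embedding.sym2Map_apply, Sym2.map_mk, Sym2.eq_iff] at h
    have := g.injective.ne hab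
    grind
  · rintro ⟨⟨a, ha, rfl⟩, ⟨b, hb, rfl⟩, hab⟩
    exact ⟨_, ⟨a, b, ⟨ha, hb, fun h => hab (h ▸ rfl)⟩, rfl⟩, rfl⟩

theorem map_bipartiteEdges (g : α ↪ β) (A B : Finset α) :
    (bipartiteEdges A B).map g.sym2Map = bipartiteEdges (A.map g) (B.map g) := by
  ext e
  induction e with | _ u v
  rw [mk_mem_bipartiteEdges]
  simp only [bipartiteEdges, Finset.mem_map, Finset.mem_image,
    Finset.mem_product, Prod.exists, Function.uncurry_apply_pair]
  constructor
  · rintro ⟨_, ⟨a, b, ⟨ha, hb⟩, rfl⟩, h⟩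
    simp only [Function.Embedding.sym2Map_apply, Sym2.map_mk, Sym2.eq_iff] at h
    grind
  · rintro (⟨⟨a, ha, rfl⟩, ⟨b, hb, rfl⟩⟩ | ⟨⟨a, ha, rfl⟩, ⟨b, hb, rfl⟩⟩)
    · exact ⟨_, ⟨a, b, ⟨ha, hb⟩, rfl⟩, rfl⟩
    · exact ⟨_, ⟨a, b, ⟨ha, hb⟩, rfl⟩, Sym2.eq_swap⟩

theorem completeEdges_union {A B : Finset α} (h : Disjoint A B) :
    completeEdges (A ∪ B) = completeEdges A ∪ completeEdges B ∪ bipartiteEdges A B := by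
  ext e
  induction e with | _ u v
  simp only [mk_mem_completeEdges, mk_mem_bipartiteEdges, Finset.mem_union]
  rw [Finset.disjoint_left] at h
  by_cases huv : u = v
  · subst huv
    grind
  · grind

theorem disjoint_completeEdges {A B : Finset α} (h : (A ∩ B).card ≤ 1) :
    Disjoint (completeEdges A) (completeEdges B) := by
  rw [Finset.disjoint_left]
  intro e
  induction e with | _ u v
  simp only [mk_mem_completeEdges]
  rintro ⟨hu, hv, huv⟩ ⟨hu', hv', -⟩
  exact huv (Finset.card_le_one.1 h u (by simp [*]) v (by simp [*]))

theorem disjoint_completeEdges_bipartiteEdges {A B C : Finset α}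
    (h : Disjoint A C ∨ Disjoint B C) : Disjoint (completeEdges C) (bipartiteEdges A B) := by
  rw [Finset.disjoint_left]
  intro e
  induction e with | _ u v
  simp only [mk_mem_completeEdges, mk_mem_bipartiteEdges, Finset.disjoint_left] at *
  grind

theorem bipartiteEdges_union_right (A B C : Finset α) :
    bipartiteEdges A (B ∪ C) = bipartiteEdges A B ∪ bipartiteEdges A C := by
  simp [bipartiteEdges, Finset.product_union, Finset.image_union]

theorem bipartiteEdges_union_left (A B C : Finset α) :
    bipartiteEdges (A ∪ B) C = bipartiteEdges A C ∪ bipartiteEdges B C := by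
  simp [bipartiteEdges, Finset.union_product, Finset.image_union]

theorem disjoint_bipartiteEdges_right {A B C : Finset α} (hAB : Disjoint A B)
    (hBC : Disjoint B C) : Disjoint (bipartiteEdges A B) (bipartiteEdges A C) := by
  rw [Finset.disjoint_left]
  intro e
  induction e with | _ u v
  simp only [mk_mem_bipartiteEdges, Finset.disjoint_left] at *
  grind

theorem disjoint_bipartiteEdges_left {A B C : Finset α} (hAB : Disjoint A B)
    (hBC : Disjoint B C) : Disjoint (bipartiteEdges A C) (bipartiteEdges B C) := by
  rw [Finset.disjoint_left]
  intro e
  induction e with | _ u v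
  simp only [mk_mem_bipartiteEdges, Finset.disjoint_left] at *
  grind

theorem completeEdges_mono {A B : Finset α} (h : A ⊆ B) : completeEdges A ⊆ completeEdges B :=
  Finset.image_subset_image (Finset.offDiag_mono h)

theorem card_completeEdges (V : Finset α) : (completeEdges V).card = V.card.choose 2 :=
  Sym2.card_image_offDiag V

end edges

/-! ### Decompositions of edge sets into paths -/

theorem Decomposes.union {W : Type*} {Γ : SimpleGraph W} {𝓑₁ 𝓑₂ : Set LGraph}
    {E₁ E₂ : Finset (Sym2 ℕ)} (h₁ : Decomposes 𝓑₁ Γ E₁) (h₂ : Decomposes 𝓑₂ Γ E₂)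
    (h : Disjoint E₁ E₂) : Decomposes (𝓑₁ ∪ 𝓑₂) Γ (E₁ ∪ E₂) := by
  rw [Finset.disjoint_left] at h
  refine ⟨?_, ?_, ?_⟩
  · rintro B (hB | hB)
    exacts [h₁.iso B hB, h₂.iso B hB]
  · rintro B (hB | hB) e he
    exacts [Finset.mem_union_left _ (h₁.subset B hB e he),
      Finset.mem_union_right _ (h₂.subset B hB e he)]
  · intro e he
    rcases Finset.mem_union.1 he with he | he
    · obtain ⟨B, ⟨hB, heB⟩, hu⟩ := h₁.partition e he
      refine ⟨B, ⟨Or.inl hB, heB⟩, ?_⟩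
      rintro B' ⟨hB' | hB', he'⟩
      exacts [hu B' ⟨hB', he'⟩, (h he (h₂.subset B' hB' e he')).elim]
    · obtain ⟨B, ⟨hB, heB⟩, hu⟩ := h₂.partition e he
      refine ⟨B, ⟨Or.inr hB, heB⟩, ?_⟩
      rintro B' ⟨hB' | hB', he'⟩
      exacts [(h (h₁.subset B' hB' e he') he).elim, hu B' ⟨hB', he'⟩]

theorem decomposes_empty {W : Type*} (Γ : SimpleGraph W) : Decomposes ∅ Γ ∅ :=
  ⟨by simp, by simp, by simp⟩

theorem decomposes_pathThree {a b c : ℕ} (hab : a ≠ b) (hac : a ≠ c) (hbc : b ≠ c) :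
    Decomposes {pathThree a b c} (pathGraph 3) {s(a, b), s(b, c)} := by
  refine ⟨?_, ?_, ?_⟩
  · rintro _ rfl
    exact nonempty_iso_pathThree_iff.2 ⟨a, b, c, hab, hac, hbc, rfl⟩
  · rintro _ rfl e he
    simpa [mem_edgeSet_pathThree hab hbc] using he
  · intro e he
    exact ⟨_, ⟨rfl, by simpa [mem_edgeSet_pathThree hab hbc] using he⟩, fun B hB => hB.1⟩

theorem decomposes_pathFour {a b c d : ℕ} (hab : a ≠ b) (hac : a ≠ c) (had : a ≠ d)
    (hbc : b ≠ c) (hbd : b ≠ d) (hcd : c ≠ d) :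
    Decomposes {pathFour a b c d} (pathGraph 4) {s(a, b), s(b, c), s(c, d)} := by
  refine ⟨?_, ?_, ?_⟩
  · rintro _ rfl
    exact nonempty_iso_pathFour_iff.2 ⟨a, b, c, d, hab, hac, had, hbc, hbd, hcd, rfl⟩
  · rintro _ rfl e he
    simpa [mem_edgeSet_pathFour hab hbc hcd] using he
  · intro e he
    exact ⟨_, ⟨rfl, by simpa [mem_edgeSet_pathFour hab hbc hcd] using he⟩, fun B hB => hB.1⟩

/-- A graph decomposed into paths on three vertices has an even number of edges. -/
theorem Decomposes.even_card {𝓑 : Set LGraph} {E : Finset (Sym2 ℕ)}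
    (h : Decomposes 𝓑 (pathGraph 3) E) : Even E.card := by
  classical
  choose! F hF hu using h.partition
  -- `F` sends an edge to its block, so its fibres are the edge sets of blocks, with two edges each.
  rw [Finset.card_eq_sum_card_image F E]
  refine Finset.even_sum _ fun B hB => ?_
  obtain ⟨e, he, rfl⟩ := Finset.mem_image.1 hB
  obtain ⟨a, b, c, hab, hac, hbc, hB'⟩ := nonempty_iso_pathThree_iff.1 (h.iso _ (hF e he).1)
  have : ({x ∈ E | F x = F e} : Finset _) = {s(a, b), s(b, c)} := by
    ext x
    rw [Finset.mem_filter, Finset.mem_insert, Finset.mem_singleton,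
      ← mem_edgeSet_pathThree hab hbc, ← hB']
    constructor
    · rintro ⟨hx, hxe⟩
      exact hxe ▸ (hF x hx).2
    · intro hx
      have hxE := h.subset _ (hF e he).1 x hx
      exact ⟨hxE, (hu x hxE _ ⟨(hF e he).1, hx⟩).symm⟩
  rw [this, Finset.card_pair (by simp [hab, hac])]
  exact even_two

theorem mem_edgeSet_completeOn {V : Finset ℕ} {e : Sym2 ℕ} :
    e ∈ (completeOn V).edgeSet ↔ e ∈ completeEdges V := by
  induction e with | _ u v
  simp [completeOn, mk_mem_completeEdges]

/-- `Γ` has no isolated vertices, so every vertex of `B` is an end of an edge and control of the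
edges suffices. This is what lets designs be treated as decompositions of edge sets. -/
theorem le_completeOn {W : Type*} {Γ : SimpleGraph W} (hΓ : ∀ w, ∃ w', Γ.Adj w w')
    {B : LGraph} (hB : Nonempty (B.coe ≃g Γ)) {V : Finset ℕ}
    (h : ∀ e ∈ B.edgeSet, e ∈ completeEdges V) : B ≤ completeOn V := by
  have key : ∀ {u v}, B.Adj u v → u ∈ V ∧ v ∈ V ∧ u ≠ v := fun huv =>
    mk_mem_completeEdges.1 (h s(_, _) huv)
  refine ⟨fun x hx => ?_, fun u v huv => ?_⟩
  · obtain ⟨e⟩ := hB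
    obtain ⟨w, hw⟩ := hΓ (e ⟨x, hx⟩)
    have := e.symm.map_rel_iff.2 hw
    rw [RelIso.symm_apply_apply] at this
    exact (key this).1
  · simpa [completeOn] using key huv

theorem isDesign_completeOn_iff {W : Type*} {Γ : SimpleGraph W} (hΓ : ∀ w, ∃ w', Γ.Adj w w')
    {𝓑 : Set LGraph} {V : Finset ℕ} :
    IsDesign 𝓑 (completeOn V) Γ ↔ Decomposes 𝓑 Γ (completeEdges V) := by
  constructor
  · intro h
    refine ⟨h.iso, fun B hB e he => ?_, fun e he => h.partition e (mem_edgeSet_completeOn.2 he)⟩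
    exact mem_edgeSet_completeOn.1 (Subgraph.edgeSet_mono (h.le B hB) he)
  · intro h
    exact ⟨fun B hB => le_completeOn hΓ (h.iso B hB) (h.subset B hB), h.iso,
      fun e he => h.partition e (mem_edgeSet_completeOn.1 he)⟩

theorem exists_adj_pathGraph_three (w : Fin 3) : ∃ w', (pathGraph 3).Adj w w' := by
  simp only [pathGraph_adj]; revert w; decide

theorem exists_adj_pathGraph_four (w : Fin 4) : ∃ w', (pathGraph 4).Adj w w' := by
  simp only [pathGraph_adj]; revert w; decide

/-- If `w` is joined to both ends of every edge avoiding it, and the number of edges is even,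
then the graph decomposes into paths on three vertices. -/
theorem exists_decomposes_of_dominating (w : ℕ) (F : Finset (Sym2 ℕ))
    (hdiag : ∀ u v, s(u, v) ∈ F → u ≠ v)
    (hw : ∀ u v, s(u, v) ∈ F → u ≠ w → v ≠ w → s(w, u) ∈ F) (hF : Even F.card) :
    ∃ 𝓑, Decomposes 𝓑 (pathGraph 3) F := by
  induction hn : F.card using Nat.strong_induction_on generalizing F with | _ n ih
  have step : ∀ a b c, a ≠ c → s(a, b) ∈ F → s(b, c) ∈ F →
      (∀ u v, s(u, v) ∈ F \ {s(a, b), s(b, c)} → u ≠ w → v ≠ w →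
        s(w, u) ∈ F \ {s(a, b), s(b, c)}) → ∃ 𝓑, Decomposes 𝓑 (pathGraph 3) F := by
    intro a b c hac hab hbc h
    have hsub : {s(a, b), s(b, c)} ⊆ F := by
      simp [Finset.insert_subset_iff, hab, hbc]
    have hc2 : ({s(a, b), s(b, c)} : Finset (Sym2 ℕ)).card = 2 :=
      Finset.card_pair (by simp [hdiag a b hab, hac])
    have hle := Finset.card_le_card hsub
    have hcard := Finset.card_sdiff_of_subset hsub
    rw [hc2] at hcard hle
    obtain ⟨𝓑, h𝓑⟩ := ih _ (by omega) (F \ {s(a, b), s(b, c)})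
      (fun u v huv => hdiag u v (Finset.mem_sdiff.1 huv).1) h (by grind) rfl
    have := h𝓑.union (decomposes_pathThree (hdiag a b hab) hac (hdiag b c hbc))
      Finset.sdiff_disjoint
    rw [Finset.sdiff_union_of_subset hsub] at this
    exact ⟨_, this⟩
  -- Paths avoiding `w` go first: removing one leaves the edges at `w` intact, so the hypothesis on
  -- `w` persists.
  by_cases h1 : ∃ a b c, a ≠ c ∧ s(a, b) ∈ F ∧ s(b, c) ∈ F ∧ a ≠ w ∧ b ≠ w ∧ c ≠ w
  · obtain ⟨a, b, c, hac, hab, hbc, ha, hb, hc⟩ := h1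
    refine step a b c hac hab hbc fun u v huv hu hv => ?_
    have := hw u v (Finset.mem_sdiff.1 huv).1 hu hv
    simp only [Finset.mem_sdiff, Finset.mem_insert, Finset.mem_singleton, Sym2.eq_iff]
    grind
  -- The edges avoiding `w` now form a matching, so once `a - b - w` is removed no remaining edge
  -- avoiding `w` meets `a` or `b`, and the loss of the edge `w b` does no harm.
  by_cases h2 : ∃ a b, s(a, b) ∈ F ∧ a ≠ w ∧ b ≠ w
  · obtain ⟨a, b, hab, ha, hb⟩ := h2
    have hba : s(b, a) ∈ F := by rwa [Sym2.eq_swap]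
    have hwb := hw b a hba hb ha
    refine step a b w ha hab (by rwa [Sym2.eq_swap]) fun u v huv hu hv => ?_
    have huv' := (Finset.mem_sdiff.1 huv).1
    have huv2 := (Finset.mem_sdiff.1 huv).2
    have := hw u v huv' hu hv
    have hub : u ≠ b := by
      rintro rfl
      refine h1 ⟨a, u, v, ?_, hab, huv', ha, hu, hv⟩
      rintro rfl
      simp [Sym2.eq_swap] at huv2
    simp only [Finset.mem_sdiff, Finset.mem_insert, Finset.mem_singleton, Sym2.eq_iff]
    grind
  -- What is left is a star at `w` with an even number of edges, which can be paired.
  have hstar : ∀ e ∈ F, ∃ u, e = s(w, u) := by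
    intro e he
    induction e with | _ u v
    by_cases hu : u = w
    · exact ⟨v, by rw [hu]⟩
    · by_cases hv : v = w
      · exact ⟨u, by rw [hv, Sym2.eq_swap]⟩
      · exact (h2 ⟨u, v, he, hu, hv⟩).elim
  rcases F.eq_empty_or_nonempty with rfl | hne
  · exact ⟨∅, decomposes_empty _⟩
  have h1lt : 1 < F.card := by
    have := hne.card_pos
    grind
  obtain ⟨e, he, e', he', hee⟩ := Finset.one_lt_card.1 h1lt
  obtain ⟨u, rfl⟩ := hstar e he
  obtain ⟨u', rfl⟩ := hstar e' he'
  refine step u w u' (fun h => hee (h ▸ rfl)) (by rwa [Sym2.eq_swap]) he' fun x y hxy hx hy => ?_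
  exact (h2 ⟨x, y, (Finset.mem_sdiff.1 hxy).1, hx, hy⟩).elim

/-! ### Linked pairs of decompositions -/

/-- The vertex `x` is an inner vertex of some block of `𝓑`. -/
def IsInner (𝓑 : Set LGraph) (x : ℕ) : Prop :=
  ∃ B ∈ 𝓑, ∃ y z, y ≠ z ∧ B.Adj x y ∧ B.Adj x z

/-- Some decomposition of `E` into copies of `P₄`, in which each vertex of `I` is an inner vertex
of some block, can be down-linked to a decomposition of `E'` into copies of `P₃`. -/
def Linked (E E' : Finset (Sym2 ℕ)) (I : Finset ℕ) : Prop :=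
  ∃ 𝓑 𝓑', Decomposes 𝓑 (pathGraph 4) E ∧ Decomposes 𝓑' (pathGraph 3) E' ∧
    CanDownLink 𝓑 𝓑' ∧ ∀ x ∈ I, IsInner 𝓑 x

theorem canDownLink_iff {𝓑 𝓑' : Set LGraph} :
    CanDownLink 𝓑 𝓑' ↔ ∀ B ∈ 𝓑, ∃ B' ∈ 𝓑', B' ≤ B := by
  constructor
  · rintro ⟨f, hf⟩ B hB
    exact ⟨f ⟨B, hB⟩, (f ⟨B, hB⟩).2, hf ⟨B, hB⟩⟩
  · intro h
    choose f hf hle using h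
    exact ⟨fun B => ⟨f B.1 B.2, hf B.1 B.2⟩, fun B => hle B.1 B.2⟩

theorem CanDownLink.union {𝓑₁ 𝓑₂ 𝓑₁' 𝓑₂' : Set LGraph} (h₁ : CanDownLink 𝓑₁ 𝓑₁')
    (h₂ : CanDownLink 𝓑₂ 𝓑₂') : CanDownLink (𝓑₁ ∪ 𝓑₂) (𝓑₁' ∪ 𝓑₂') := by
  rw [canDownLink_iff] at *
  rintro B (hB | hB)
  · obtain ⟨B', hB', hle⟩ := h₁ B hB
    exact ⟨B', Or.inl hB', hle⟩
  · obtain ⟨B', hB', hle⟩ := h₂ B hB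
    exact ⟨B', Or.inr hB', hle⟩

theorem Linked.union {E₁ E₂ E₁' E₂' : Finset (Sym2 ℕ)} {I₁ I₂ : Finset ℕ}
    (h₁ : Linked E₁ E₁' I₁) (h₂ : Linked E₂ E₂' I₂) (h : Disjoint E₁ E₂)
    (h' : Disjoint E₁' E₂') : Linked (E₁ ∪ E₂) (E₁' ∪ E₂') (I₁ ∪ I₂) := by
  obtain ⟨𝓑₁, 𝓑₁', hd₁, hd₁', hl₁, hi₁⟩ := h₁
  obtain ⟨𝓑₂, 𝓑₂', hd₂, hd₂', hl₂, hi₂⟩ := h₂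
  refine ⟨_, _, hd₁.union hd₂ h, hd₁'.union hd₂' h', hl₁.union hl₂, fun x hx => ?_⟩
  rcases Finset.mem_union.1 hx with hx | hx
  · obtain ⟨B, hB, hx⟩ := hi₁ x hx
    exact ⟨B, Or.inl hB, hx⟩
  · obtain ⟨B, hB, hx⟩ := hi₂ x hx
    exact ⟨B, Or.inr hB, hx⟩

theorem Linked.mono {E E' : Finset (Sym2 ℕ)} {I J : Finset ℕ} (h : Linked E E' I) (hJ : J ⊆ I) :
    Linked E E' J := by
  obtain ⟨𝓑, 𝓑', hd, hd', hl, hi⟩ := h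
  exact ⟨𝓑, 𝓑', hd, hd', hl, fun x hx => hi x (hJ hx)⟩

theorem linked_empty : Linked ∅ ∅ ∅ :=
  ⟨∅, ∅, decomposes_empty _, decomposes_empty _, canDownLink_iff.2 (by simp), by simp⟩

/-- A down-link need not be surjective, so further copies of `P₃` may be added to the target freely.
-/
theorem Linked.union_decomposes {E E' F : Finset (Sym2 ℕ)} {I : Finset ℕ} {𝓑 : Set LGraph}
    (h : Linked E E' I) (h𝓑 : Decomposes 𝓑 (pathGraph 3) F) (hF : Disjoint E' F) :
    Linked E (E' ∪ F) I := by
  have : Linked ∅ F ∅ := ⟨∅, 𝓑, decomposes_empty _, h𝓑, canDownLink_iff.2 (by simp), by simp⟩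
  simpa using h.union this (by simp) hF

theorem linked_pathFour {a b c d : ℕ} (hab : a ≠ b) (hac : a ≠ c) (had : a ≠ d)
    (hbc : b ≠ c) (hbd : b ≠ d) (hcd : c ≠ d) :
    Linked {s(a, b), s(b, c), s(c, d)} {s(b, c), s(c, d)} {b, c} := by
  refine ⟨_, _, decomposes_pathFour hab hac had hbc hbd hcd, decomposes_pathThree hbc hbd hcd,
    canDownLink_iff.2 ?_, fun x hx => ⟨_, rfl, ?_⟩⟩
  · rintro _ rfl
    exact ⟨_, rfl, pathThree_le_pathFour a b c d⟩
  · simp only [Finset.mem_insert, Finset.mem_singleton] at hx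
    rcases hx with rfl | rfl
    · exact ⟨a, c, hac, by simp [pathFour, hab.symm], by simp [pathFour, hbc]⟩
    · exact ⟨b, d, hbd, by simp [pathFour, hbc.symm], by simp [pathFour, hcd]⟩

/-! ### Finite tables encoding linked pairs -/

section tables

variable {α : Type*} [DecidableEq α]

/-- The edges of the path through the given three vertices. -/
def edgesThree (t : α × α × α) : List (Sym2 α) :=
  [s(t.1, t.2.1), s(t.2.1, t.2.2)]

/-- The edges of the path through the given four vertices. -/
def edgesFour (t : α × α × α × α) : List (Sym2 α) :=
  s(t.1, t.2.1) :: edgesThree t.2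

/-- The paths on four vertices in `L` decompose `E`, the paths on three vertices obtained from
them by deleting their first vertices form, together with those in `X`, a decomposition of `E'`,
and every vertex of `I` is an inner vertex of some path in `L`. -/
structure IsLinkTable (L : List (α × α × α × α)) (X : List (α × α × α)) (E E' : Finset (Sym2 α))
    (I : Finset α) : Prop where
  nodup_four : L.Forall fun t => [t.1, t.2.1, t.2.2.1, t.2.2.2].Nodup
  nodup_three : X.Forall fun t => [t.1, t.2.1, t.2.2].Nodup
  nodup_edges_four : (L.flatMap edgesFour).Nodup
  nodup_edges_three : ((L.map Prod.snd).flatMap edgesThree ++ X.flatMap edgesThree).Nodup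
  edges_four : ∀ u v, s(u, v) ∈ E ↔ s(u, v) ∈ L.flatMap edgesFour
  edges_three : ∀ u v, s(u, v) ∈ E' ↔
    s(u, v) ∈ (L.map Prod.snd).flatMap edgesThree ++ X.flatMap edgesThree
  inner : ∀ u ∈ I, u ∈ L.flatMap fun t => [t.2.1, t.2.2.1]

theorem linked_map_of_nodup (g : α ↪ ℕ) (L : List (α × α × α × α))
    (hL : ∀ t ∈ L, [t.1, t.2.1, t.2.2.1, t.2.2.2].Nodup) (h : (L.flatMap edgesFour).Nodup)
    (h' : ((L.map Prod.snd).flatMap edgesThree).Nodup) :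
    Linked ((L.flatMap edgesFour).toFinset.map g.sym2Map)
      (((L.map Prod.snd).flatMap edgesThree).toFinset.map g.sym2Map)
      ((L.flatMap fun t => [t.2.1, t.2.2.1]).toFinset.map g) := by
  induction L with
  | nil => exact linked_empty
  | cons t L ih =>
    obtain ⟨a, b, c, d⟩ := t
    simp only [List.flatMap_cons, List.map_cons, List.nodup_append', List.toFinset_append,
      Finset.map_union] at h h' ⊢
    have ht := hL _ List.mem_cons_self
    simp only [List.nodup_cons, List.mem_cons, List.not_mem_nil, not_or, or_false] at ht
    obtain ⟨⟨hab, hac, had⟩, ⟨hbc, hbd⟩, hcd, -⟩ := ht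
    refine Linked.union ?_ (ih (fun t ht => hL t (List.mem_cons_of_mem _ ht)) h.2.1 h'.2.1) ?_ ?_
    · have := linked_pathFour (g.injective.ne hab) (g.injective.ne hac) (g.injective.ne had)
        (g.injective.ne hbc) (g.injective.ne hbd) (g.injective.ne hcd)
      simpa [edgesFour, edgesThree] using this
    · rw [Finset.disjoint_map, List.disjoint_toFinset_iff_disjoint]
      exact h.2.2
    · rw [Finset.disjoint_map, List.disjoint_toFinset_iff_disjoint]
      exact h'.2.2

theorem exists_decomposes_map_of_nodup (g : α ↪ ℕ) (X : List (α × α × α))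
    (hX : ∀ t ∈ X, [t.1, t.2.1, t.2.2].Nodup) (h : (X.flatMap edgesThree).Nodup) :
    ∃ 𝓑, Decomposes 𝓑 (pathGraph 3) ((X.flatMap edgesThree).toFinset.map g.sym2Map) := by
  induction X with
  | nil => exact ⟨∅, decomposes_empty _⟩
  | cons t X ih =>
    obtain ⟨a, b, c⟩ := t
    simp only [List.flatMap_cons, List.nodup_append', List.toFinset_append,
      Finset.map_union] at h ⊢
    have ht := hX _ List.mem_cons_self
    simp only [List.nodup_cons, List.mem_cons, List.not_mem_nil, not_or, or_false] at ht
    obtain ⟨⟨hab, hac⟩, hbc, -⟩ := ht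
    obtain ⟨𝓑, h𝓑⟩ := ih (fun t ht => hX t (List.mem_cons_of_mem _ ht)) h.2.1
    have := decomposes_pathThree (g.injective.ne hab) (g.injective.ne hac) (g.injective.ne hbc)
    refine ⟨_, Decomposes.union (𝓑₁ := {pathThree (g a) (g b) (g c)}) ?_ h𝓑 ?_⟩
    · simpa [edgesThree] using this
    · rw [Finset.disjoint_map, List.disjoint_toFinset_iff_disjoint]
      exact h.2.2

theorem IsLinkTable.linked {L : List (α × α × α × α)} {X : List (α × α × α)}
    {E E' : Finset (Sym2 α)} {I : Finset α} (h : IsLinkTable L X E E' I) (g : α ↪ ℕ) :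
    Linked (E.map g.sym2Map) (E'.map g.sym2Map) (I.map g) := by
  obtain ⟨h4, h3, n4, n3, hE, hE', hI⟩ := h
  obtain rfl : E = (L.flatMap edgesFour).toFinset := by
    ext e
    induction e with | _ u v
    rw [hE, List.mem_toFinset]
  obtain rfl : E' =
      ((L.map Prod.snd).flatMap edgesThree ++ X.flatMap edgesThree).toFinset := by
    ext e
    induction e with | _ u v
    rw [hE', List.mem_toFinset]
  replace hI : I ⊆ (L.flatMap fun t => [t.2.1, t.2.2.1]).toFinset :=
    fun u hu => List.mem_toFinset.2 (hI u hu)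
  rw [List.forall_iff_forall_mem] at h4 h3
  rw [List.nodup_append'] at n3
  obtain ⟨𝓑, h𝓑⟩ := exists_decomposes_map_of_nodup g X h3 n3.2.1
  rw [List.toFinset_append, Finset.map_union]
  refine ((linked_map_of_nodup g L h4 n4 n3.1).mono (Finset.map_subset_map.2 hI)).union_decomposes
    h𝓑 ?_
  rw [Finset.disjoint_map, List.disjoint_toFinset_iff_disjoint]
  exact n3.2.2

end tables

/-! ### Transport of tables to arbitrary vertex sets -/

theorem exists_embedding_map_univ {k : ℕ} {V : Finset ℕ} (hV : V.card = k) :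
    ∃ g : Fin k ↪ ℕ, Finset.univ.map g = V :=
  ⟨(V.orderEmbOfFin hV).toEmbedding, Finset.map_orderEmbOfFin_univ V hV⟩

theorem exists_embedding_map_castAdd_natAdd {a b : ℕ} {A B : Finset ℕ} (hA : A.card = a)
    (hB : B.card = b) (h : Disjoint A B) :
    ∃ g : Fin (a + b) ↪ ℕ, (Finset.univ.map (Fin.castAddEmb b)).map g = A ∧
      (Finset.univ.map (Fin.natAddEmb a)).map g = B := by
  obtain ⟨f, hf⟩ := exists_embedding_map_univ hA
  obtain ⟨f', hf'⟩ := exists_embedding_map_univ hB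
  have hinj : Function.Injective (Sum.elim f f') := by
    refine f.injective.sumElim f'.injective fun i j hij => ?_
    have hi : f i ∈ A := hf ▸ Finset.mem_map_of_mem f (Finset.mem_univ i)
    have hj : f' j ∈ B := hf' ▸ Finset.mem_map_of_mem f' (Finset.mem_univ j)
    exact Finset.disjoint_left.1 h hi (hij ▸ hj)
  refine ⟨finSumFinEquiv.symm.toEmbedding.trans ⟨_, hinj⟩, ?_, ?_⟩
  · rw [← hf, Finset.map_map]
    congr 1
    ext i
    simp
  · rw [← hf', Finset.map_map]
    congr 1
    ext i
    simp

theorem IsLinkTable.linked_completeEdges {k : ℕ} {L : List (Fin k × Fin k × Fin k × Fin k)}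
    {X : List (Fin k × Fin k × Fin k)} {I : Finset (Fin k)}
    (h : IsLinkTable L X (completeEdges Finset.univ) (completeEdges Finset.univ) I)
    {V : Finset ℕ} (hV : V.card = k) : Linked (completeEdges V) (completeEdges V) ∅ := by
  obtain ⟨g, rfl⟩ := exists_embedding_map_univ hV
  simpa only [map_completeEdges] using (h.linked g).mono (Finset.empty_subset _)

theorem IsLinkTable.exists_linked_completeEdges {k : ℕ}
    {L : List (Fin k × Fin k × Fin k × Fin k)} {X : List (Fin k × Fin k × Fin k)}
    {E : Finset (Sym2 (Fin k))}
    (h : IsLinkTable L X (completeEdges Finset.univ) E Finset.univ)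
    {V : Finset ℕ} (hV : V.card = k) :
    ∃ E' ⊆ completeEdges V, Linked (completeEdges V) E' V := by
  obtain ⟨g, rfl⟩ := exists_embedding_map_univ hV
  rw [← map_completeEdges]
  -- Over `Fin k` the inclusion only says that `E` has no loops, which holds since each of its edges
  -- lies in a block.
  refine ⟨_, Finset.map_subset_map.2 ?_, h.linked g⟩
  intro e he
  obtain ⟨-, 𝓑, -, h𝓑, -⟩ := h.linked g
  obtain ⟨B, ⟨-, hB⟩, -⟩ := h𝓑.partition _ (Finset.mem_map_of_mem _ he)
  induction e with | _ u v
  have huv : B.Adj (g u) (g v) := hB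
  exact mk_mem_completeEdges.2 ⟨Finset.mem_univ u, Finset.mem_univ v,
    fun h => huv.ne (h ▸ rfl)⟩

theorem IsLinkTable.linked_bipartiteEdges {a b : ℕ}
    {L : List (Fin (a + b) × Fin (a + b) × Fin (a + b) × Fin (a + b))}
    {X : List (Fin (a + b) × Fin (a + b) × Fin (a + b))} {I : Finset (Fin (a + b))}
    (h : IsLinkTable L X
      (bipartiteEdges (Finset.univ.map (Fin.castAddEmb b)) (Finset.univ.map (Fin.natAddEmb a)))
      (bipartiteEdges (Finset.univ.map (Fin.castAddEmb b)) (Finset.univ.map (Fin.natAddEmb a))) I)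
    {A B : Finset ℕ} (hA : A.card = a) (hB : B.card = b) (hAB : Disjoint A B) :
    Linked (bipartiteEdges A B) (bipartiteEdges A B) ∅ := by
  obtain ⟨g, rfl, rfl⟩ := exists_embedding_map_castAdd_natAdd hA hB hAB
  simpa only [map_bipartiteEdges] using (h.linked g).mono (Finset.empty_subset _)

/-- The last element of `Fin (a + 1)` plays the part of the apex `w`. -/
theorem IsLinkTable.linked_cone {a : ℕ}
    {L : List (Fin (a + 1) × Fin (a + 1) × Fin (a + 1) × Fin (a + 1))}
    {X : List (Fin (a + 1) × Fin (a + 1) × Fin (a + 1))} {I : Finset (Fin (a + 1))}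
    (h : IsLinkTable L X (completeEdges Finset.univ)
      (completeEdges (Finset.univ.map (Fin.castAddEmb 1))) I)
    {A : Finset ℕ} (hA : A.card = a) {w : ℕ} (hw : w ∉ A) :
    Linked (completeEdges (insert w A)) (completeEdges A) ∅ := by
  obtain ⟨g, rfl, hB⟩ := exists_embedding_map_castAdd_natAdd hA (Finset.card_singleton w)
    (Finset.disjoint_singleton_right.2 hw)
  have huniv : (Finset.univ : Finset (Fin (a + 1))) =
      Finset.univ.map (Fin.natAddEmb a) ∪ Finset.univ.map (Fin.castAddEmb 1) := by
    ext i
    induction i using Fin.addCases with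
    | left i => simp
    | right i => simpa using Or.inl (Subsingleton.elim i 0)
  have := (h.linked g).mono (Finset.empty_subset _)
  rwa [map_completeEdges, map_completeEdges, huniv, Finset.map_union, hB,
    ← Finset.insert_eq] at this

/-! ### Base tables -/

/-- In each table the first list holds the `P₄`-blocks, oriented so that the first edge is the one
cut off; the second list decomposes the target edges still uncovered. With edge membership unfolded,
all conditions are decidable over `Fin`. -/
theorem exists_isLinkTable_four : ∃ L X, IsLinkTable (α := Fin 4) L X
    (completeEdges Finset.univ)
    (completeEdges Finset.univ) Finset.univ := by
  refine ⟨
    [(2, 0, 3, 1), (0, 1, 2, 3)],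
    [(1, 0, 2)],
    ?_, ?_, ?_, ?_, ?_, ?_, ?_⟩ <;>
  try simp only [mk_mem_completeEdges]
  all_goals decide +kernel

theorem exists_isLinkTable_nine : ∃ L X, IsLinkTable (α := Fin 9) L X
    (completeEdges Finset.univ)
    (completeEdges Finset.univ) Finset.univ := by
  refine ⟨
    [(3, 1, 5, 4), (7, 0, 5, 3), (6, 2, 7, 5), (6, 0, 2, 5), (5, 6, 8, 3), (5, 8, 0, 4),
     (1, 0, 3, 2), (4, 1, 8, 2), (4, 6, 7, 8), (6, 3, 4, 8), (3, 7, 1, 6), (7, 4, 2, 1)],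
    [(8, 5, 6), (2, 6, 3), (0, 6, 4), (1, 4, 7), (7, 0, 1), (7, 3, 1)],
    ?_, ?_, ?_, ?_, ?_, ?_, ?_⟩ <;>
  try simp only [mk_mem_completeEdges]
  all_goals decide +kernel

theorem exists_isLinkTable_twelve : ∃ L X, IsLinkTable (α := Fin 12) L X
    (completeEdges Finset.univ)
    (completeEdges Finset.univ) ∅ := by
  refine ⟨
    [(10, 1, 5, 6), (2, 10, 5, 11), (2, 5, 8, 1), (5, 9, 0, 1), (3, 5, 0, 2), (5, 7, 2, 8),
     (9, 10, 4, 5), (0, 10, 6, 4), (6, 7, 10, 8), (10, 3, 7, 4), (10, 11, 8, 4), (1, 6, 8, 7),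
     (2, 11, 0, 8), (8, 3, 9, 7), (2, 4, 9, 8), (1, 11, 7, 0), (7, 1, 3, 11), (0, 3, 4, 11),
     (11, 9, 1, 4), (9, 2, 6, 11), (4, 0, 6, 9), (6, 3, 2, 1)],
    [(0, 4, 2), (8, 3, 0), (7, 6, 3), (6, 1, 7), (7, 5, 3), (9, 5, 2), (2, 9, 11), (2, 11, 1),
     (2, 10, 1), (3, 10, 0), (11, 10, 9)],
    ?_, ?_, ?_, ?_, ?_, ?_, ?_⟩ <;>
  try simp only [mk_mem_completeEdges]
  all_goals decide +kernel

theorem exists_isLinkTable_thirteen : ∃ L X, IsLinkTable (α := Fin 13) L X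
    (completeEdges Finset.univ)
    (completeEdges Finset.univ) ∅ := by
  refine ⟨
    [(3, 5, 9, 11), (3, 9, 8, 12), (12, 9, 1, 7), (2, 9, 7, 10), (2, 6, 10, 9), (8, 7, 6, 9),
     (4, 9, 0, 11), (7, 12, 10, 8), (7, 3, 12, 4), (2, 5, 7, 0), (3, 4, 7, 2), (1, 10, 11, 7),
     (1, 3, 10, 2), (6, 0, 5, 10), (11, 3, 0, 10), (10, 4, 6, 3), (3, 2, 4, 5), (3, 8, 1, 0),
     (8, 11, 4, 0), (2, 0, 8, 4), (8, 2, 12, 0), (4, 1, 11, 2), (6, 12, 1, 2), (12, 11, 6, 5),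
     (6, 1, 5, 12), (6, 8, 5, 11)],
    [(1, 10, 4), (1, 4, 9), (7, 12, 9), (11, 12, 6), (1, 6, 0), (7, 8, 11), (8, 6, 2), (0, 2, 8),
     (9, 2, 5), (5, 3, 9), (8, 3, 4), (7, 3, 2), (11, 3, 1)],
    ?_, ?_, ?_, ?_, ?_, ?_, ?_⟩ <;>
  try simp only [mk_mem_completeEdges]
  all_goals decide +kernel

/-- `K₆` has 15 edges, an odd number, so the target cannot be all of it. Only the inner-vertex
condition matters here, and the target is whatever the shortened blocks cover. -/
theorem exists_isLinkTable_six : ∃ L X E, IsLinkTable (α := Fin 6) L X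
    (completeEdges Finset.univ)
    E Finset.univ := by
  refine ⟨
    [(0, 1, 2, 4), (1, 4, 3, 0), (2, 5, 0, 4), (0, 2, 3, 5), (4, 5, 1, 3)],
    -- The target set is fixed by unification below as the finset of edges of the shortened paths.
    [], _,
    ?_, ?_, ?_, ?_, ?_, fun _ _ => List.mem_toFinset, ?_⟩ <;>
  try simp only [mk_mem_completeEdges]
  all_goals decide +kernel

theorem exists_isLinkTable_seven : ∃ L X E, IsLinkTable (α := Fin 7) L X
    (completeEdges Finset.univ)
    E Finset.univ := by
  refine ⟨
    [(3, 2, 1, 0), (6, 3, 1, 5), (1, 6, 5, 3), (0, 2, 4, 1), (2, 6, 4, 0), (6, 0, 5, 2),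
     (5, 4, 3, 0)],
    [], _,
    ?_, ?_, ?_, ?_, ?_, fun _ _ => List.mem_toFinset, ?_⟩ <;>
  try simp only [mk_mem_completeEdges]
  all_goals decide +kernel

theorem exists_isLinkTable_six_two : ∃ L X, IsLinkTable (α := Fin (6 + 2)) L X
    (bipartiteEdges (Finset.univ.map (Fin.castAddEmb 2)) (Finset.univ.map (Fin.natAddEmb 6)))
    (bipartiteEdges (Finset.univ.map (Fin.castAddEmb 2)) (Finset.univ.map (Fin.natAddEmb 6))) ∅ := by
  refine ⟨
    [(3, 6, 0, 7), (3, 7, 1, 6), (6, 5, 7, 4), (7, 2, 6, 4)],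
    [(2, 7, 3), (3, 6, 5)],
    ?_, ?_, ?_, ?_, ?_, ?_, ?_⟩ <;>
  try simp only [mk_mem_bipartiteEdges]
  all_goals decide +kernel

theorem exists_isLinkTable_six_three : ∃ L X, IsLinkTable (α := Fin (6 + 3)) L X
    (bipartiteEdges (Finset.univ.map (Fin.castAddEmb 3)) (Finset.univ.map (Fin.natAddEmb 6)))
    (bipartiteEdges (Finset.univ.map (Fin.castAddEmb 3)) (Finset.univ.map (Fin.natAddEmb 6))) ∅ := by
  refine ⟨
    [(6, 4, 8, 1), (4, 7, 5, 6), (6, 2, 8, 5), (2, 7, 0, 6), (7, 3, 8, 0), (7, 1, 6, 3)],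
    [(2, 6, 4), (4, 7, 2), (3, 7, 1)],
    ?_, ?_, ?_, ?_, ?_, ?_, ?_⟩ <;>
  try simp only [mk_mem_bipartiteEdges]
  all_goals decide +kernel

theorem exists_isLinkTable_cone_five : ∃ L X, IsLinkTable (α := Fin (5 + 1)) L X
    (completeEdges Finset.univ)
    (completeEdges (Finset.univ.map (Fin.castAddEmb 1))) ∅ := by
  refine ⟨
    [(5, 2, 0, 1), (5, 4, 3, 0), (5, 0, 4, 2), (5, 1, 2, 3), (5, 3, 1, 4)],
    [],
    ?_, ?_, ?_, ?_, ?_, ?_, ?_⟩ <;>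
  try simp only [mk_mem_completeEdges]
  all_goals decide +kernel

theorem exists_isLinkTable_cone_eight : ∃ L X, IsLinkTable (α := Fin (8 + 1)) L X
    (completeEdges Finset.univ)
    (completeEdges (Finset.univ.map (Fin.castAddEmb 1))) ∅ := by
  refine ⟨
    [(8, 2, 1, 5), (8, 4, 6, 1), (8, 1, 4, 2), (8, 6, 2, 7), (8, 7, 5, 6), (8, 0, 1, 3),
     (8, 3, 2, 5), (8, 5, 3, 4), (0, 3, 7, 1), (2, 0, 5, 4), (3, 6, 0, 7), (0, 4, 7, 6)],
    [(6, 3, 0), (4, 0, 2)],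
    ?_, ?_, ?_, ?_, ?_, ?_, ?_⟩ <;>
  try simp only [mk_mem_completeEdges]
  all_goals decide +kernel

theorem exists_isLinkTable_cone_nine : ∃ L X, IsLinkTable (α := Fin (9 + 1)) L X
    (completeEdges Finset.univ)
    (completeEdges (Finset.univ.map (Fin.castAddEmb 1))) ∅ := by
  refine ⟨
    [(9, 0, 3, 2), (9, 5, 8, 0), (9, 7, 6, 2), (9, 3, 4, 1), (9, 8, 6, 4), (9, 1, 3, 6),
     (9, 4, 7, 1), (9, 2, 8, 4), (9, 6, 1, 8), (7, 5, 6, 0), (4, 5, 3, 8), (2, 0, 7, 3),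
     (5, 2, 7, 8), (0, 1, 2, 4), (4, 0, 5, 1)],
    [(1, 0, 4), (0, 2, 5), (4, 5, 7)],
    ?_, ?_, ?_, ?_, ?_, ?_, ?_⟩ <;>
  try simp only [mk_mem_completeEdges]
  all_goals decide +kernel

theorem exists_isLinkTable_cone_twelve : ∃ L X, IsLinkTable (α := Fin (12 + 1)) L X
    (completeEdges Finset.univ)
    (completeEdges (Finset.univ.map (Fin.castAddEmb 1))) ∅ := by
  refine ⟨
    [(12, 6, 5, 4), (12, 2, 3, 1), (12, 5, 10, 4), (12, 1, 4, 9), (12, 9, 2, 1), (12, 8, 3, 11),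
     (12, 11, 0, 10), (12, 7, 2, 0), (12, 4, 8, 10), (12, 10, 6, 0), (12, 0, 8, 6),
     (12, 3, 5, 0), (8, 1, 0, 4), (10, 3, 0, 7), (0, 9, 3, 6), (9, 11, 4, 3), (6, 4, 7, 3),
     (7, 10, 2, 4), (11, 10, 9, 7), (7, 11, 1, 10), (11, 2, 8, 9), (7, 5, 2, 6), (8, 7, 6, 9),
     (5, 9, 1, 7), (11, 5, 1, 6), (6, 11, 8, 5)],
    [(4, 6, 11), (1, 8, 7), (0, 9, 5), (3, 10, 7), (7, 5, 11), (2, 11, 9), (7, 11, 10)],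
    ?_, ?_, ?_, ?_, ?_, ?_, ?_⟩ <;>
  try simp only [mk_mem_completeEdges]
  all_goals decide +kernel

/-! ### Recursive constructions -/

theorem exists_subset_card_disjoint_union {V : Finset ℕ} {k m : ℕ} (hV : V.card = m + k) :
    ∃ A B, A.card = m ∧ B.card = k ∧ Disjoint A B ∧ V = A ∪ B := by
  obtain ⟨B, hB, hBk⟩ := Finset.exists_subset_card_eq (s := V) (n := k) (by omega)
  exact ⟨V \ B, B, by rw [Finset.card_sdiff_of_subset hB]; omega, hBk, Finset.sdiff_disjoint,
    (Finset.sdiff_union_of_subset hB).symm⟩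

/-- Every number except 1 is a sum of twos and at most one three, so the tables for `K_{6,2}` and
`K_{6,3}` suffice. The exception is genuine: a star contains no `P₄`. -/
theorem linked_bipartiteEdges_six {A B : Finset ℕ} (hA : A.card = 6) (hB : B.card ≠ 1)
    (hAB : Disjoint A B) : Linked (bipartiteEdges A B) (bipartiteEdges A B) ∅ := by
  induction hn : B.card using Nat.strong_induction_on generalizing B with | _ n ih
  subst hn
  by_cases h0 : B.card = 0
  · rw [Finset.card_eq_zero.1 h0]
    simpa [bipartiteEdges] using linked_empty
  by_cases h3 : B.card = 3
  · obtain ⟨L, X, h⟩ := exists_isLinkTable_six_three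
    exact h.linked_bipartiteEdges hA h3 hAB
  obtain ⟨C, D, hC, hD, hCD, rfl⟩ :=
    exists_subset_card_disjoint_union (V := B) (k := 2) (m := B.card - 2) (by omega)
  rw [Finset.disjoint_union_right] at hAB
  obtain ⟨L, X, h⟩ := exists_isLinkTable_six_two
  rw [bipartiteEdges_union_right]
  have hd := disjoint_bipartiteEdges_right hAB.1 hCD
  exact (ih _ (by omega) (by omega) hAB.1 rfl).union (h.linked_bipartiteEdges hA hD hAB.2) hd hd

theorem linked_bipartiteEdges_twelve {A B : Finset ℕ} (hA : A.card = 12) (hB : B.card ≠ 1)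
    (hAB : Disjoint A B) : Linked (bipartiteEdges A B) (bipartiteEdges A B) ∅ := by
  obtain ⟨C, D, hC, hD, hCD, rfl⟩ :=
    exists_subset_card_disjoint_union (V := A) (k := 6) (m := 6) hA
  rw [Finset.disjoint_union_left] at hAB
  rw [bipartiteEdges_union_left]
  have hd := disjoint_bipartiteEdges_left hCD hAB.2
  exact (linked_bipartiteEdges_six hC hB hAB.1).union (linked_bipartiteEdges_six hD hB hAB.2) hd hd

/-- Every admissible complete graph has a decomposition into copies of `P₄` in which each vertex
is an inner vertex of some block. -/
theorem exists_linked_completeEdges {V : Finset ℕ} (h4 : 4 ≤ V.card)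
    (hV : V.card % 3 = 0 ∨ V.card % 3 = 1) :
    ∃ E' ⊆ completeEdges V, Linked (completeEdges V) E' V := by
  induction hn : V.card using Nat.strong_induction_on generalizing V with | _ n ih
  subst hn
  by_cases h10 : V.card < 10
  · obtain h | h | h | h : V.card = 4 ∨ V.card = 6 ∨ V.card = 7 ∨ V.card = 9 := by omega
    · obtain ⟨L, X, hT⟩ := exists_isLinkTable_four
      exact hT.exists_linked_completeEdges h
    · obtain ⟨L, X, E, hT⟩ := exists_isLinkTable_six
      exact hT.exists_linked_completeEdges h
    · obtain ⟨L, X, E, hT⟩ := exists_isLinkTable_seven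
      exact hT.exists_linked_completeEdges h
    · obtain ⟨L, X, hT⟩ := exists_isLinkTable_nine
      exact hT.exists_linked_completeEdges h
  -- Splitting off six vertices keeps the residue modulo 3 and leaves at least four. The two parts
  -- already make all their own vertices inner, so the bipartite piece need not contribute any.
  obtain ⟨A, B, hA, hB, hAB, rfl⟩ :=
    exists_subset_card_disjoint_union (V := V) (k := 6) (m := V.card - 6) (by omega)
  obtain ⟨EA, hEA, hLA⟩ := ih A.card (by omega) (V := A) (by omega) (by omega) rfl
  obtain ⟨L, X, E, hT⟩ := exists_isLinkTable_six
  obtain ⟨EB, hEB, hLB⟩ := hT.exists_linked_completeEdges hB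
  have hLAB := linked_bipartiteEdges_six hB (B := A) (by omega) hAB.symm
  have hd : Disjoint (completeEdges A) (completeEdges B) :=
    disjoint_completeEdges (by simp [Finset.disjoint_iff_inter_eq_empty.1 hAB])
  have hd' : Disjoint (completeEdges A ∪ completeEdges B) (bipartiteEdges B A) :=
    Finset.disjoint_union_left.2 ⟨disjoint_completeEdges_bipartiteEdges (Or.inl hAB.symm),
      disjoint_completeEdges_bipartiteEdges (Or.inr hAB)⟩
  have hcomm : bipartiteEdges A B = bipartiteEdges B A := by
    ext e
    induction e with | _ u v
    rw [mk_mem_bipartiteEdges, mk_mem_bipartiteEdges]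
    tauto
  have := (hLA.union hLB hd (hd.mono hEA hEB)).union hLAB hd'
    (hd'.mono_left (Finset.union_subset_union hEA hEB))
  rw [completeEdges_union hAB, hcomm]
  exact ⟨_, Finset.union_subset_union (Finset.union_subset_union hEA hEB) subset_rfl,
    by simpa using this⟩

/-- The residues are those that are 0 or 1 both modulo 3 and modulo 4. Splitting off 12 vertices
leaves a `K_{12,m}`, unavailable for `m = 1`; hence order 13 is a base case and order 1 is excluded.
-/
theorem linked_completeEdges_self {V : Finset ℕ} (h1 : V.card ≠ 1)
    (hV : V.card % 12 = 0 ∨ V.card % 12 = 1 ∨ V.card % 12 = 4 ∨ V.card % 12 = 9) :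
    Linked (completeEdges V) (completeEdges V) ∅ := by
  induction hn : V.card using Nat.strong_induction_on generalizing V with | _ n ih
  subst hn
  by_cases h14 : V.card < 14
  · obtain h | h | h | h | h :
      V.card = 0 ∨ V.card = 4 ∨ V.card = 9 ∨ V.card = 12 ∨ V.card = 13 := by omega
    · rw [Finset.card_eq_zero.1 h]
      exact linked_empty
    · obtain ⟨L, X, hT⟩ := exists_isLinkTable_four
      exact hT.linked_completeEdges h
    · obtain ⟨L, X, hT⟩ := exists_isLinkTable_nine
      exact hT.linked_completeEdges h
    · obtain ⟨L, X, hT⟩ := exists_isLinkTable_twelve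
      exact hT.linked_completeEdges h
    · obtain ⟨L, X, hT⟩ := exists_isLinkTable_thirteen
      exact hT.linked_completeEdges h
  obtain ⟨B, A, hB, hA, hAB, rfl⟩ :=
    exists_subset_card_disjoint_union (V := V) (k := V.card - 12) (m := 12) (by omega)
  obtain ⟨L, X, hT⟩ := exists_isLinkTable_twelve
  have hd : Disjoint (completeEdges B) (completeEdges A) :=
    disjoint_completeEdges (by simp [Finset.disjoint_iff_inter_eq_empty.1 hAB])
  have hd' : Disjoint (completeEdges B ∪ completeEdges A) (bipartiteEdges B A) :=
    Finset.disjoint_union_left.2 ⟨disjoint_completeEdges_bipartiteEdges (Or.inr hAB.symm),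
      disjoint_completeEdges_bipartiteEdges (Or.inl hAB)⟩
  rw [completeEdges_union hAB]
  exact (((hT.linked_completeEdges hB).union
    (ih A.card (by omega) (V := A) (by omega) (by omega) rfl) hd hd).union
    (linked_bipartiteEdges_twelve hB (by omega) hAB) hd' hd')

/-- Some decomposition of the complete graph on `V ∪ {w}` into copies of `P₄` can be down-linked
to a decomposition of the complete graph on `V` into copies of `P₃`. -/
theorem linked_completeEdges_insert {V : Finset ℕ} {w : ℕ} (hw : w ∉ V)
    (hV : V.card % 12 = 0 ∨ V.card % 12 = 5 ∨ V.card % 12 = 8 ∨ V.card % 12 = 9) :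
    Linked (completeEdges (insert w V)) (completeEdges V) ∅ := by
  induction hn : V.card using Nat.strong_induction_on generalizing V with | _ n ih
  subst hn
  -- The residues express that `V.card` is 0 or 1 modulo 4 and `V.card + 1` is 0 or 1 modulo 3.
  by_cases h14 : V.card < 13
  · obtain h | h | h | h | h :
      V.card = 0 ∨ V.card = 5 ∨ V.card = 8 ∨ V.card = 9 ∨ V.card = 12 := by omega
    · rw [Finset.card_eq_zero.1 h]
      exact linked_empty
    · obtain ⟨L, X, hT⟩ := exists_isLinkTable_cone_five
      exact hT.linked_cone h hw
    · obtain ⟨L, X, hT⟩ := exists_isLinkTable_cone_eight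
      exact hT.linked_cone h hw
    · obtain ⟨L, X, hT⟩ := exists_isLinkTable_cone_nine
      exact hT.linked_cone h hw
    · obtain ⟨L, X, hT⟩ := exists_isLinkTable_cone_twelve
      exact hT.linked_cone h hw
  obtain ⟨B, A, hB, hA, hAB, rfl⟩ :=
    exists_subset_card_disjoint_union (V := V) (k := V.card - 12) (m := 12) (by omega)
  rw [Finset.mem_union, not_or] at hw
  obtain ⟨L, X, hT⟩ := exists_isLinkTable_cone_twelve
  -- The cones over `B` and `A` share only their apex, hence no edge; the edges between `B` and `A`
  -- complete the picture on both sides of the link.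
  have hinter : insert w B ∩ insert w A = {w} := by
    ext x
    have := Finset.disjoint_left.1 hAB
    simp only [Finset.mem_inter, Finset.mem_insert, Finset.mem_singleton]
    grind
  have hd : Disjoint (completeEdges (insert w B)) (completeEdges (insert w A)) :=
    disjoint_completeEdges (by simp [hinter])
  have hd' : Disjoint (completeEdges (insert w B) ∪ completeEdges (insert w A))
      (bipartiteEdges B A) := by
    refine Finset.disjoint_union_left.2 ⟨disjoint_completeEdges_bipartiteEdges (Or.inr ?_),
      disjoint_completeEdges_bipartiteEdges (Or.inl ?_)⟩
    · exact Finset.disjoint_insert_right.2 ⟨hw.2, hAB.symm⟩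
    · exact Finset.disjoint_insert_right.2 ⟨hw.1, hAB⟩
  have hsub : completeEdges B ∪ completeEdges A ⊆
      completeEdges (insert w B) ∪ completeEdges (insert w A) :=
    Finset.union_subset_union (completeEdges_mono (Finset.subset_insert _ _))
      (completeEdges_mono (Finset.subset_insert _ _))
  have hE : completeEdges (insert w (B ∪ A)) =
      completeEdges (insert w B) ∪ completeEdges (insert w A) ∪ bipartiteEdges B A := by
    ext e
    induction e with | _ u v
    simp only [mk_mem_completeEdges, mk_mem_bipartiteEdges, Finset.mem_union, Finset.mem_insert]
    have := Finset.disjoint_left.1 hAB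
    by_cases u = v <;> grind
  rw [hE, completeEdges_union hAB]
  exact ((hT.linked_cone hB hw.1).union (ih A.card (by omega) hw.2 (by omega) rfl) hd
    (hd.mono (completeEdges_mono (Finset.subset_insert _ _))
      (completeEdges_mono (Finset.subset_insert _ _)))).union
    (linked_bipartiteEdges_twelve hB (by omega) hAB) hd' (hd'.mono_left hsub)

/-! ### Parity, and all orders of the first spectrum -/

theorem even_choose_two_iff {n : ℕ} : Even (n.choose 2) ↔ n ≡ 0 [MOD 4] ∨ n ≡ 1 [MOD 4] := by
  rw [Nat.choose_two_right]
  simp only [Nat.ModEq, Nat.even_iff]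
  obtain ⟨k, rfl | rfl | rfl | rfl⟩ : ∃ k, n = 4 * k ∨ n = 4 * k + 1 ∨ n = 4 * k + 2 ∨
      n = 4 * k + 3 := ⟨n / 4, by omega⟩
  · have : 4 * k * (4 * k - 1) / 2 = 2 * (k * (4 * k - 1)) := by
      rw [show 4 * k * (4 * k - 1) = 2 * (2 * (k * (4 * k - 1))) by ring]; omega
    omega
  · have : (4 * k + 1) * (4 * k + 1 - 1) / 2 = 2 * (k * (4 * k + 1)) := by
      rw [Nat.add_sub_cancel, show (4 * k + 1) * (4 * k) = 2 * (2 * (k * (4 * k + 1))) by ring]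
      omega
    omega
  · have : (4 * k + 2) * (4 * k + 2 - 1) / 2 = 2 * (4 * k * k + 3 * k) + 1 := by
      rw [show 4 * k + 2 - 1 = 4 * k + 1 by omega,
        show (4 * k + 2) * (4 * k + 1) = 2 * (2 * (4 * k * k + 3 * k) + 1) by ring]
      omega
    omega
  · have : (4 * k + 3) * (4 * k + 3 - 1) / 2 = 2 * (4 * k * k + 5 * k + 1) + 1 := by
      rw [show 4 * k + 3 - 1 = 4 * k + 2 by omega,
        show (4 * k + 3) * (4 * k + 2) = 2 * (2 * (4 * k * k + 5 * k + 1) + 1) by ring]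
      omega
    omega

/-- Since `E'` lives on `V`, a vertex `w` of `V'` outside `V` keeps all its edges in the complement
of `E'`. That complement has even size because `E'`, being decomposed into copies of `P₃`, does. -/
theorem Linked.completeEdges_of_ssubset {V V' : Finset ℕ} {E' : Finset (Sym2 ℕ)} {I : Finset ℕ}
    (h : Linked (completeEdges V) E' I) (hE' : E' ⊆ completeEdges V) (hV : V ⊂ V')
    (heven : Even (V'.card.choose 2)) : Linked (completeEdges V) (completeEdges V') I := by
  obtain ⟨w, hwV', hwV⟩ := Finset.exists_of_ssubset hV
  have hsub : E' ⊆ completeEdges V' := hE'.trans (completeEdges_mono hV.subset)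
  have hE'even : Even E'.card := by
    obtain ⟨-, 𝓑', -, h𝓑', -⟩ := h
    exact h𝓑'.even_card
  obtain ⟨𝓑, h𝓑⟩ := exists_decomposes_of_dominating w (completeEdges V' \ E')
    (fun u v huv => (mk_mem_completeEdges.1 (Finset.mem_sdiff.1 huv).1).2.2)
    (fun u v huv hu _ => by
      have := mk_mem_completeEdges.1 (Finset.mem_sdiff.1 huv).1
      exact Finset.mem_sdiff.2 ⟨mk_mem_completeEdges.2 ⟨hwV', this.1, hu.symm⟩,
        fun hwu => hwV (mk_mem_completeEdges.1 (hE' hwu)).1⟩)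
    (by
      rw [Finset.card_sdiff_of_subset hsub, Nat.even_sub (Finset.card_le_card hsub),
        card_completeEdges]
      exact iff_of_true heven hE'even)
  have := h.union_decomposes h𝓑 Finset.disjoint_sdiff
  rwa [Finset.union_sdiff_of_subset hsub] at this

theorem PathAdmissible.mod_three {v : ℕ} (h : PathAdmissible 4 v) : v % 3 = 0 ∨ v % 3 = 1 := by
  obtain ⟨h4, h⟩ := h
  have h3 : 3 ∣ v * (v - 1) := Dvd.dvd.trans (by norm_num) ((Nat.modEq_zero_iff_dvd).1 h)
  rcases (Nat.Prime.dvd_mul Nat.prime_three).1 h3 with h | h <;> omega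

theorem mem_downLinkSpectrum₁_of_linked {V V' I : Finset ℕ}
    (h : Linked (completeEdges V) (completeEdges V') I) :
    V'.card ∈ downLinkSpectrum₁ (pathGraph 4) (pathGraph 3) V.card := by
  obtain ⟨𝓑, 𝓑', h𝓑, h𝓑', hl, -⟩ := h
  exact ⟨𝓑, 𝓑', ⟨V, rfl, (isDesign_completeOn_iff exists_adj_pathGraph_four).2 h𝓑⟩,
    ⟨V', rfl, (isDesign_completeOn_iff exists_adj_pathGraph_three).2 h𝓑'⟩, hl⟩

theorem mem_downLinkSpectrum₁_of_le {v n : ℕ} (hadm : PathAdmissible 4 v) (hvn : v - 1 ≤ n)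
    (hn : n ≡ 0 [MOD 4] ∨ n ≡ 1 [MOD 4]) :
    n ∈ downLinkSpectrum₁ (pathGraph 4) (pathGraph 3) v := by
  have h4 := hadm.1
  have h3 := hadm.mod_three
  have hn' := hn
  simp only [Nat.ModEq] at hn'
  rcases lt_trichotomy n v with h | rfl | h
  -- Here `n = v - 1`, and the vertex `n` serves as the apex over `Finset.range n`.
  · have := mem_downLinkSpectrum₁_of_linked (linked_completeEdges_insert (V := Finset.range n)
      (w := n) (by simp) (by rw [Finset.card_range]; omega))
    rwa [Finset.card_insert_of_notMem (by simp), Finset.card_range,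
      show n + 1 = v by omega] at this
  · have := mem_downLinkSpectrum₁_of_linked (linked_completeEdges_self (V := Finset.range n)
      (by rw [Finset.card_range]; omega) (by rw [Finset.card_range]; omega))
    rwa [Finset.card_range] at this
  · obtain ⟨E', hE', hl⟩ := exists_linked_completeEdges (V := Finset.range v)
      (by rwa [Finset.card_range]) (by rwa [Finset.card_range])
    have := mem_downLinkSpectrum₁_of_linked (hl.completeEdges_of_ssubset hE'
      (V' := Finset.range n) (Finset.ssubset_iff_subset_ne.2
        ⟨Finset.range_subset_range.2 h.le, fun he => h.ne (by simpa using congrArg Finset.card he)⟩)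
      (by rw [Finset.card_range]; exact even_choose_two_iff.2 hn))
    rwa [Finset.card_range, Finset.card_range] at this

/-! ### Necessary conditions and the theorem -/

theorem edges_mem_of_pathThree_le_pathFour {a b c a' b' c' d' : ℕ} (hab : a ≠ b) (hbc : b ≠ c)
    (h : pathThree a b c ≤ pathFour a' b' c' d') :
    s(a, b) ∈ ({s(a', b'), s(b', c'), s(c', d')} : Set (Sym2 ℕ)) ∧
      s(b, c) ∈ ({s(a', b'), s(b', c'), s(c', d')} : Set (Sym2 ℕ)) :=
  ⟨(h.2 (show (pathThree a b c).Adj a b from ⟨hab, Or.inl rfl⟩)).2,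
    (h.2 (show (pathThree a b c).Adj b c from ⟨hbc, Or.inr rfl⟩)).2⟩

/-- A copy of `P₃` inside a copy of `P₄` misses exactly one vertex, and that one is an end. -/
theorem mem_verts_of_le {B B' : LGraph} (hB : Nonempty (B.coe ≃g pathGraph 4))
    (hB' : Nonempty (B'.coe ≃g pathGraph 3)) (hle : B' ≤ B) :
    (∀ x y, B.Adj x y → x ∈ B'.verts ∨ y ∈ B'.verts) ∧
      ∀ x y z, y ≠ z → B.Adj x y → B.Adj x z → x ∈ B'.verts := by
  obtain ⟨a', b', c', d', h1, h2, h3, h4, h5, h6, rfl⟩ := nonempty_iso_pathFour_iff.1 hB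
  obtain ⟨a, b, c, hab, hac, hbc, rfl⟩ := nonempty_iso_pathThree_iff.1 hB'
  have := edges_mem_of_pathThree_le_pathFour hab hbc hle
  simp only [Set.mem_insert_iff, Set.mem_singleton_iff, Sym2.eq_iff] at this
  simp only [pathFour, pathThree, Set.mem_insert_iff, Set.mem_singleton_iff, Sym2.eq_iff]
  constructor
  · intro x y
    grind
  · intro x y z
    grind

theorem Decomposes.verts_subset {W : Type*} {Γ : SimpleGraph W} (hΓ : ∀ w, ∃ w', Γ.Adj w w')
    {𝓑 : Set LGraph} {V : Finset ℕ} (h : Decomposes 𝓑 Γ (completeEdges V)) {B : LGraph}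
    (hB : B ∈ 𝓑) {x : ℕ} (hx : x ∈ B.verts) : x ∈ V := by
  have := ((isDesign_completeOn_iff hΓ).2 h).le B hB
  simpa [completeOn] using this.1 hx

/-- Two vertices of `V` outside `V'` would be joined by an edge of some block, and a `P₃` in that
block keeps at least one of them. -/
theorem card_le_card_add_one_of_canDownLink {V V' : Finset ℕ} {𝓑 𝓑' : Set LGraph}
    (h𝓑 : Decomposes 𝓑 (pathGraph 4) (completeEdges V))
    (h𝓑' : Decomposes 𝓑' (pathGraph 3) (completeEdges V')) (h : CanDownLink 𝓑 𝓑') :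
    V.card ≤ V'.card + 1 := by
  have hle : (V \ V').card ≤ 1 := by
    refine Finset.card_le_one.2 fun x hx y hy => ?_
    by_contra hxy
    rw [Finset.mem_sdiff] at hx hy
    obtain ⟨B, ⟨hB, hadj⟩, -⟩ := h𝓑.partition s(x, y) (mk_mem_completeEdges.2 ⟨hx.1, hy.1, hxy⟩)
    obtain ⟨B', hB', hle⟩ := canDownLink_iff.1 h B hB
    rcases (mem_verts_of_le (h𝓑.iso B hB) (h𝓑'.iso B' hB') hle).1 x y hadj with h | h
    · exact hx.2 (h𝓑'.verts_subset exists_adj_pathGraph_three hB' h)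
    · exact hy.2 (h𝓑'.verts_subset exists_adj_pathGraph_three hB' h)
  have := Finset.card_le_card_sdiff_add_card (s := V) (t := V')
  omega

theorem card_le_card_of_isInner {V V' : Finset ℕ} {𝓑 𝓑' : Set LGraph}
    (h𝓑 : Decomposes 𝓑 (pathGraph 4) (completeEdges V))
    (h𝓑' : Decomposes 𝓑' (pathGraph 3) (completeEdges V')) (h : CanDownLink 𝓑 𝓑')
    (hI : ∀ x ∈ V, IsInner 𝓑 x) : V.card ≤ V'.card := by
  refine Finset.card_le_card fun x hx => ?_
  obtain ⟨B, hB, y, z, hyz, hy, hz⟩ := hI x hx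
  obtain ⟨B', hB', hle⟩ := canDownLink_iff.1 h B hB
  exact h𝓑'.verts_subset exists_adj_pathGraph_three hB'
    ((mem_verts_of_le (h𝓑.iso B hB) (h𝓑'.iso B' hB') hle).2 x y z hyz hy hz)

theorem theoremt (v : ℕ) (hv : 1 < v) (hadm : PathAdmissible 4 v) :
    downLinkSpectrum₁ (SimpleGraph.pathGraph 4) (SimpleGraph.pathGraph 3) v =
        {n : ℕ | v - 1 ≤ n ∧ (n ≡ 0 [MOD 4] ∨ n ≡ 1 [MOD 4])} ∧
      downLinkSpectrum₂ (SimpleGraph.pathGraph 4) (SimpleGraph.pathGraph 3) v ⊆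
        {n : ℕ | v ≤ n ∧ (n ≡ 0 [MOD 4] ∨ n ≡ 1 [MOD 4])} := by
  refine ⟨Set.Subset.antisymm ?_ fun n hn => mem_downLinkSpectrum₁_of_le hadm hn.1 hn.2, ?_⟩
  · rintro n ⟨𝓑, 𝓑', ⟨V, rfl, h𝓑⟩, ⟨V', rfl, h𝓑'⟩, hl⟩
    rw [isDesign_completeOn_iff exists_adj_pathGraph_four] at h𝓑
    rw [isDesign_completeOn_iff exists_adj_pathGraph_three] at h𝓑'
    refine ⟨Nat.sub_le_of_le_add (card_le_card_add_one_of_canDownLink h𝓑 h𝓑' hl), ?_⟩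
    rw [← even_choose_two_iff, ← card_completeEdges]
    exact h𝓑'.even_card
  · intro n hn
    -- The universal condition is tested on a single design, one in which every vertex is inner.
    obtain ⟨E', -, 𝓑, -, h𝓑, -, -, hI⟩ := exists_linked_completeEdges (V := Finset.range v)
      (by rw [Finset.card_range]; exact hadm.1) (by rw [Finset.card_range]; exact hadm.mod_three)
    obtain ⟨𝓑', ⟨V', rfl, h𝓑'⟩, hl⟩ := hn 𝓑 ⟨_, Finset.card_range v,
      (isDesign_completeOn_iff exists_adj_pathGraph_four).2 h𝓑⟩
    rw [isDesign_completeOn_iff exists_adj_pathGraph_three] at h𝓑'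
    refine ⟨?_, ?_⟩
    · simpa using card_le_card_of_isInner h𝓑 h𝓑' hl hI
    · rw [← even_choose_two_iff, ← card_completeEdges]
      exact h𝓑'.even_card
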